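/- Let $\Delta=\{\zeta\in\mathbb C:|\zeta|<1\}$ and let $d_\Delta(\zeta,\zeta')=\operatorname{artanh}\left|\frac{\zeta-\zeta'}{1-\overline{\zeta'}\,\zeta}\right|$ be the Poincaré distance on $\Delta$. For $k\ge 0$, a map $f:\Delta\to\mathbb C$ of class $\mathcal C^1$ (in the real sense) is called $k$-quasiconformal if $\left|\frac{\partial f}{\partial\bar\zeta}(z)\right|\le k\left|\frac{\partial f}{\partial\zeta}(z)\right|$ for all $z\in\Delta$. Let $0\le k<1$. Then every $k$-quasiconformal homeomorphism of $\Delta$ onto itself is a quasi-isometry for $d_\Delta$, with constants depending only on $k$: there exist $\lambda>0$ and $c>0$, depending only on $k$, such that for every homeomorphism $f:\Delta\to\Delta$ of class $\mathcal C^1$ which is $k$-quasiconformal and for all $\zeta,\zeta'\in\Delta$, $$\frac1\lambda\,d_\Delta(\zeta,\zeta')-c\ \le\ d_\Delta(f(\zeta),f(\zeta'))\ \le\ \lambda\,d_\Delta(\zeta,\zeta')+c .$$ -/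

import Mathlib

noncomputable section

/-- The open unit disc `Δ` in the complex plane. -/
def unitDisc : Set ℂ := Metric.ball 0 1

/-- The Poincaré distance on the unit disc, the distance of the Riemannian metric
`|dz|² / (1 - |z|²)²`: it is `artanh |(z - w) / (1 - conj w * z)|`. -/
def poincareDist (z w : ℂ) : ℝ :=
  Real.artanh ‖(z - w) / (1 - (starRingEnd ℂ) w * z)‖

/-- The derivative `∂f/∂ζ = (∂f/∂x - i ∂f/∂y) / 2`. -/
def wirtinger (f : ℂ → ℂ) (z : ℂ) : ℂ :=
  (fderiv ℝ f z 1 - Complex.I * fderiv ℝ f z Complex.I) / 2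

/-- The derivative `∂f/∂ζ̄ = (∂f/∂x + i ∂f/∂y) / 2`. -/
def wirtingerBar (f : ℂ → ℂ) (z : ℂ) : ℂ :=
  (fderiv ℝ f z 1 + Complex.I * fderiv ℝ f z Complex.I) / 2

/-- `f` is of class `C¹` (in the real sense) and `k`-quasiconformal on the domain `Ω`. -/
structure IsQuasiconformalOn (k : ℝ) (f : ℂ → ℂ) (Ω : Set ℂ) : Prop where
  contDiffOn : ContDiffOn ℝ 1 f Ω
  norm_wirtingerBar_le : ∀ z ∈ Ω, ‖wirtingerBar f z‖ ≤ k * ‖wirtinger f z‖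

/-- `f`, viewed as a map on the set `S` with distance `d`, with values in a space with
distance `d'`, satisfies the two inequalities of a quasi-isometry with constants `lam` and `c`. -/
def IsQuasiIsometryOnWith {X Y : Type*} (d : X → X → ℝ) (d' : Y → Y → ℝ)
    (lam c : ℝ) (f : X → Y) (S : Set X) : Prop :=
  ∀ x ∈ S, ∀ y ∈ S,
    1 / lam * d x y - c ≤ d' (f x) (f y) ∧ d' (f x) (f y) ≤ lam * d x y + c

end

/-!
The area of the disc is finite and, for a `k`-quasiconformal map, the energy `∫ ‖Df‖²` is at most
`K = (1 + k) / (1 - k)` times the area of the image. By the length–area method, a family of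
concentric circular arcs with radii between `a` and `b`, whose images all join points at distance
at least `l`, therefore satisfies `l² log (b / a) ≤ 2π² K`.

Take `f 0 = 0`. Full circles centred at `0` show that `f z` is close to `0` when `z` is. Arcs
centred at the boundary point `z / ‖z‖` show that `z` stays away from the boundary when
`‖f z‖ ≤ 1 / 2`. Quasiconformality and the Poincaré distance are invariant under Möbius
automorphisms, so these estimates hold around every point: `f` is bounded at a small scale, and so
is its inverse. Since points at Poincaré distance `d` are joined by a chain of about `d / δ` steps
of length `δ`, this bounds both `f` and its inverse affinely at all scales.
-/

open MeasureTheory Set Filter Topology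
open scoped ComplexConjugate ENNReal

section LengthArea

theorem sq_lintegral_le_measure_univ_mul_lintegral_sq {α : Type*} [MeasurableSpace α]
    {μ : Measure α} {φ : α → ℝ≥0∞} (hφ : AEMeasurable φ μ) :
    (∫⁻ x, φ x ∂μ) ^ 2 ≤ μ univ * ∫⁻ x, φ x ^ 2 ∂μ := by
  have holder := ENNReal.lintegral_mul_le_Lp_mul_Lq μ Real.HolderConjugate.two_two
    (aemeasurable_const (b := (1 : ℝ≥0∞))) hφ
  have h := pow_le_pow_left₀ zero_le holder 2
  have sq_rpow_half (a : ℝ≥0∞) : (a ^ (1 / 2 : ℝ)) ^ 2 = a := by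
    rw [← ENNReal.rpow_mul_natCast]
    norm_num
  simpa only [Pi.mul_apply, one_mul, ENNReal.rpow_two, ENNReal.one_rpow, lintegral_const,
    mul_pow, one_pow, sq_rpow_half] using h

variable {E : Type*} [NormedAddCommGroup E] [NormedSpace ℝ E] {g : ℂ → E} {U : Set ℂ}

theorem enorm_sub_circleMap_le_lintegral (hU : IsOpen U) (hg : ContDiffOn ℝ 1 g U) {p : ℂ}
    {r s t : ℝ} (hst : s ≤ t) (harc : MapsTo (circleMap p r) (Icc s t) U) :
    ‖g (circleMap p r t) - g (circleMap p r s)‖ₑ ≤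
      ∫⁻ θ in Icc s t, ‖fderiv ℝ g (circleMap p r θ)‖ₑ * ‖r‖ₑ := by
  have hcomp : ContDiffOn ℝ 1 (g ∘ circleMap p r) (Icc s t) :=
    hg.comp (contDiff_circleMap p r).contDiffOn harc
  refine (enorm_sub_le_lintegral_deriv_of_contDiffOn_Icc hcomp hst).trans
    (setLIntegral_mono' measurableSet_Icc fun θ hθ => ?_)
  have hgθ : DifferentiableAt ℝ g (circleMap p r θ) :=
    (hg.differentiableOn one_ne_zero).differentiableAt (hU.mem_nhds (harc hθ))
  rw [(hgθ.hasFDerivAt.comp_hasDerivAt θ (hasDerivAt_circleMap p r θ)).deriv]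
  exact ((fderiv ℝ g (circleMap p r θ)).le_opENorm _).trans_eq (by simp [← ofReal_norm])

theorem sq_enorm_sub_circleMap_le (hU : IsOpen U) (hg : ContDiffOn ℝ 1 g U) {p : ℂ}
    {r s t : ℝ} (hr : 0 ≤ r) (hs : s ∈ Icc (-Real.pi) Real.pi) (ht : t ∈ Icc (-Real.pi) Real.pi)
    (harc : MapsTo (circleMap p r) (uIcc s t) U) :
    ‖g (circleMap p r s) - g (circleMap p r t)‖ₑ ^ 2 ≤
      ENNReal.ofReal (2 * Real.pi * r) * ∫⁻ θ in Ioo (-Real.pi) Real.pi,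
        ENNReal.ofReal r * U.indicator (fun z => ‖fderiv ℝ g z‖ₑ ^ 2) (circleMap p r θ) := by
  wlog hst : s ≤ t generalizing s t
  · rw [← enorm_neg, neg_sub]
    exact this ht hs (uIcc_comm s t ▸ harc) (le_of_not_ge hst)
  rw [uIcc_of_le hst] at harc
  have hmeas : AEMeasurable (fun θ => ‖fderiv ℝ g (circleMap p r θ)‖ₑ * ‖r‖ₑ)
      (volume.restrict (Icc s t)) := by
    have hcont : ContinuousOn (fun θ => fderiv ℝ g (circleMap p r θ)) (Icc s t) :=
      (hg.continuousOn_fderiv_of_isOpen hU le_rfl).comp (by fun_prop) harc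
    exact (hcont.enorm.aemeasurable measurableSet_Icc).mul_const _
  calc ‖g (circleMap p r s) - g (circleMap p r t)‖ₑ ^ 2
      ≤ (∫⁻ θ in Icc s t, ‖fderiv ℝ g (circleMap p r θ)‖ₑ * ‖r‖ₑ) ^ 2 := by
        rw [← enorm_neg, neg_sub]
        gcongr
        exact enorm_sub_circleMap_le_lintegral hU hg hst harc
    _ ≤ volume (Icc s t) * ∫⁻ θ in Icc s t, (‖fderiv ℝ g (circleMap p r θ)‖ₑ * ‖r‖ₑ) ^ 2 := by
        simpa using sq_lintegral_le_measure_univ_mul_lintegral_sq hmeas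
    _ = volume (Icc s t) * ENNReal.ofReal r * ∫⁻ θ in Icc s t,
          ENNReal.ofReal r * U.indicator (fun z => ‖fderiv ℝ g z‖ₑ ^ 2) (circleMap p r θ) := by
        rw [mul_assoc, ← lintegral_const_mul' _ _ ENNReal.ofReal_ne_top]
        congr 1
        refine setLIntegral_congr_fun measurableSet_Icc fun θ hθ => ?_
        simp only [indicator_of_mem (harc hθ), Real.enorm_of_nonneg hr]
        ring
    _ ≤ _ := by
        rw [setLIntegral_congr Ioo_ae_eq_Icc, Real.volume_Icc,
          ENNReal.ofReal_mul' hr]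
        gcongr
        · linarith [hs.1, ht.2]
        · exact hs.1
        · exact ht.2

theorem lintegral_eq_lintegral_circleMap {φ : ℂ → ℝ≥0∞} (hφ : Measurable φ) (p : ℂ) :
    ∫⁻ z, φ z = ∫⁻ r in Ioi 0, ∫⁻ θ in Ioo (-Real.pi) Real.pi,
      ENNReal.ofReal r * φ (circleMap p r θ) := by
  have hpolar (q : ℝ × ℝ) : p + Complex.polarCoord.symm q = circleMap p q.1 q.2 := by
    simp [circleMap, Complex.exp_mul_I]
  have hmeas : Measurable fun q : ℝ × ℝ => ENNReal.ofReal q.1 * φ (circleMap p q.1 q.2) := by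
    refine measurable_fst.ennreal_ofReal.mul (hφ.comp ?_)
    unfold circleMap
    fun_prop
  calc ∫⁻ z, φ z = ∫⁻ z, φ (p + z) := (lintegral_add_left_eq_self φ p).symm
    _ = ∫⁻ q in polarCoord.target, ENNReal.ofReal q.1 • φ (p + Complex.polarCoord.symm q) :=
      (Complex.lintegral_comp_polarCoord_symm fun z => φ (p + z)).symm
    _ = _ := by
      simp_rw [hpolar, smul_eq_mul]
      rw [polarCoord_target, Measure.volume_eq_prod, setLIntegral_prod _ hmeas.aemeasurable]

theorem lintegral_Ioo_ofReal_div {a b : ℝ} (ha : 0 < a) (hab : a ≤ b) {C : ℝ} (hC : 0 ≤ C) :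
    ∫⁻ r in Ioo a b, ENNReal.ofReal (C / r) = ENNReal.ofReal (C * Real.log (b / a)) := by
  have hint : IntegrableOn (fun r : ℝ => C / r) (Ioc a b) :=
    ((continuousOn_const.div continuousOn_id fun _ hr => (ha.trans_le hr.1).ne').integrableOn_Icc
      ).mono_set Ioc_subset_Icc_self
  have hnonneg : 0 ≤ᵐ[volume.restrict (Ioc a b)] fun r => C / r :=
    (ae_restrict_iff' measurableSet_Ioc).2
      (Eventually.of_forall fun r hr => div_nonneg hC (ha.trans hr.1).le)
  rw [setLIntegral_congr Ioo_ae_eq_Ioc, ← ofReal_integral_eq_lintegral_ofReal hint hnonneg,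
    ← intervalIntegral.integral_of_le hab, ← integral_one_div_of_pos ha (ha.trans_le hab),
    ← intervalIntegral.integral_const_mul]
  simp only [mul_one_div]

/-- Cauchy–Schwarz on each circle bounds `l² / (2πr)` by the energy of that circle; integrating
over the radius turns `1 / r` into the logarithm. -/
theorem ofReal_sq_mul_log_le_lintegral_enorm_fderiv_sq [CompleteSpace E] (hU : IsOpen U)
    (hg : ContDiffOn ℝ 1 g U) {p : ℂ} {a b l : ℝ} (ha : 0 < a) (hab : a ≤ b) (hl : 0 ≤ l)
    (harc : ∀ r ∈ Ioo a b, ∃ s ∈ Icc (-Real.pi) Real.pi, ∃ t ∈ Icc (-Real.pi) Real.pi,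
      MapsTo (circleMap p r) (uIcc s t) U ∧
        l ≤ ‖g (circleMap p r s) - g (circleMap p r t)‖) :
    ENNReal.ofReal (l ^ 2 / (2 * Real.pi) * Real.log (b / a)) ≤
      ∫⁻ z in U, ‖fderiv ℝ g z‖ₑ ^ 2 := by
  set energy : ℂ → ℝ≥0∞ := U.indicator fun z => ‖fderiv ℝ g z‖ₑ ^ 2
  have henergy : Measurable energy :=
    ((measurable_fderiv ℝ g).enorm.pow_const 2).indicator hU.measurableSet
  have hcircle : ∀ r ∈ Ioo a b, ENNReal.ofReal (l ^ 2 / (2 * Real.pi) / r) ≤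
      ∫⁻ θ in Ioo (-Real.pi) Real.pi, ENNReal.ofReal r * energy (circleMap p r θ) := by
    intro r hr
    obtain ⟨s, hs, t, ht, hmaps, hlst⟩ := harc r hr
    have hr0 : 0 < r := ha.trans hr.1
    rw [div_div, ENNReal.ofReal_div_of_pos (by positivity), ENNReal.ofReal_pow hl]
    refine ENNReal.div_le_of_le_mul' (le_trans ?_
      (sq_enorm_sub_circleMap_le hU hg hr0.le hs ht hmaps))
    rw [← ofReal_norm]
    gcongr
  rw [← lintegral_indicator hU.measurableSet, lintegral_eq_lintegral_circleMap henergy p,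
    ← lintegral_Ioo_ofReal_div ha hab (by positivity)]
  exact (setLIntegral_mono' measurableSet_Ioo hcircle).trans
    (lintegral_mono_set fun r hr => ha.trans hr.1)

end LengthArea

section Wirtinger

theorem fderiv_apply_eq_wirtinger (f : ℂ → ℂ) (z v : ℂ) :
    fderiv ℝ f z v = wirtinger f z * v + wirtingerBar f z * conj v := by
  have hv : fderiv ℝ f z v = v.re * fderiv ℝ f z 1 + v.im * fderiv ℝ f z Complex.I := by
    have hsplit : v = v.re • (1 : ℂ) + v.im • Complex.I := by simp
    conv_lhs => rw [hsplit, map_add, map_smul, map_smul]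
    simp only [Complex.real_smul]
  have hconj : conj v = v.re - v.im * Complex.I := by apply Complex.ext <;> simp
  rw [hv, hconj, wirtinger, wirtingerBar]
  linear_combination
    (-(fderiv ℝ f z 1 - Complex.I * fderiv ℝ f z Complex.I) / 2) * (Complex.re_add_im v).symm
      + (fderiv ℝ f z Complex.I * v.im) * Complex.I_mul_I

theorem wirtinger_eq_and_wirtingerBar_eq {f : ℂ → ℂ} {z p q : ℂ}
    (h : ∀ v, fderiv ℝ f z v = p * v + q * conj v) :
    wirtinger f z = p ∧ wirtingerBar f z = q := by
  simp only [wirtinger, wirtingerBar, h, map_one, Complex.conj_I]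
  constructor
  · linear_combination (-(p - q) / 2) * Complex.I_mul_I
  · linear_combination ((p - q) / 2) * Complex.I_mul_I

theorem det_fderiv_eq_wirtinger (f : ℂ → ℂ) (z : ℂ) :
    (fderiv ℝ f z).det = ‖wirtinger f z‖ ^ 2 - ‖wirtingerBar f z‖ ^ 2 := by
  have hdet : (fderiv ℝ f z).det = (fderiv ℝ f z 1).re * (fderiv ℝ f z Complex.I).im
      - (fderiv ℝ f z 1).im * (fderiv ℝ f z Complex.I).re := by
    rw [ContinuousLinearMap.det, ← LinearMap.det_toMatrix Complex.basisOneI, Matrix.det_fin_two]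
    simp only [LinearMap.toMatrix_apply, Complex.coe_basisOneI, Complex.coe_basisOneI_repr,
      Matrix.cons_val_zero, Matrix.cons_val_one, Matrix.cons_val_fin_one,
      ContinuousLinearMap.coe_coe]
    ring
  rw [hdet]
  simp only [← Complex.normSq_eq_norm_sq, Complex.normSq_apply, wirtinger, wirtingerBar,
    Complex.div_ofNat_re, Complex.div_ofNat_im, Complex.add_re, Complex.add_im, Complex.sub_re,
    Complex.sub_im, Complex.mul_re, Complex.mul_im, Complex.I_re, Complex.I_im]
  ring

theorem norm_fderiv_le_wirtinger (f : ℂ → ℂ) (z : ℂ) :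
    ‖fderiv ℝ f z‖ ≤ ‖wirtinger f z‖ + ‖wirtingerBar f z‖ := by
  refine (fderiv ℝ f z).opNorm_le_bound (by positivity) fun v => ?_
  calc ‖fderiv ℝ f z v‖ ≤ ‖wirtinger f z * v‖ + ‖wirtingerBar f z * conj v‖ :=
        fderiv_apply_eq_wirtinger f z v ▸ norm_add_le _ _
    _ = _ := by rw [norm_mul, norm_mul, Complex.norm_conj, add_mul]

namespace IsQuasiconformalOn

variable {k : ℝ} {f A : ℂ → ℂ} {Ω Ω' : Set ℂ}

theorem differentiableAt (hf : IsQuasiconformalOn k f Ω) (hΩ : IsOpen Ω) {z : ℂ} (hz : z ∈ Ω) :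
    DifferentiableAt ℝ f z :=
  (hf.contDiffOn.differentiableOn one_ne_zero).differentiableAt (hΩ.mem_nhds hz)

theorem norm_fderiv_sq_le (hf : IsQuasiconformalOn k f Ω) (hk : k < 1) {z : ℂ} (hz : z ∈ Ω) :
    ‖fderiv ℝ f z‖ ^ 2 ≤ (1 + k) / (1 - k) * (fderiv ℝ f z).det := by
  have hqp : ‖wirtingerBar f z‖ ≤ k * ‖wirtinger f z‖ := hf.norm_wirtingerBar_le z hz
  rw [det_fderiv_eq_wirtinger, div_mul_eq_mul_div, le_div_iff₀ (sub_pos.2 hk)]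
  set p := ‖wirtinger f z‖
  set q := ‖wirtingerBar f z‖
  calc ‖fderiv ℝ f z‖ ^ 2 * (1 - k) ≤ (p + q) ^ 2 * (1 - k) :=
        mul_le_mul_of_nonneg_right
          (pow_le_pow_left₀ (norm_nonneg _) (norm_fderiv_le_wirtinger f z) 2) (sub_pos.2 hk).le
    _ = (p + q) * ((p + q) * (1 - k)) := by ring
    _ ≤ (p + q) * ((1 + k) * (p - q)) := by
        refine mul_le_mul_of_nonneg_left ?_ (add_nonneg (norm_nonneg _) (norm_nonneg _))
        linarith
    _ = (1 + k) * (p ^ 2 - q ^ 2) := by ring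

theorem comp_differentiableOn (hf : IsQuasiconformalOn k f Ω) (hΩ : IsOpen Ω) (hΩ' : IsOpen Ω')
    (hA : DifferentiableOn ℂ A Ω') (hmaps : MapsTo A Ω' Ω) :
    IsQuasiconformalOn k (f ∘ A) Ω' where
  contDiffOn := hf.contDiffOn.comp ((hA.contDiffOn hΩ').restrict_scalars ℝ) hmaps
  norm_wirtingerBar_le z hz := by
    have hAz : DifferentiableAt ℂ A z := hA.differentiableAt (hΩ'.mem_nhds hz)
    obtain ⟨hp, hq⟩ := wirtinger_eq_and_wirtingerBar_eq (f := f ∘ A) (z := z)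
        (p := wirtinger f (A z) * deriv A z) (q := wirtingerBar f (A z) * conj (deriv A z)) (by
      intro v
      rw [fderiv_comp z (hf.differentiableAt hΩ (hmaps hz)) (hAz.restrictScalars ℝ),
        hAz.fderiv_restrictScalars ℝ, ContinuousLinearMap.comp_apply,
        ContinuousLinearMap.coe_restrictScalars', fderiv_apply_eq_wirtinger,
        fderiv_eq_smul_deriv, smul_eq_mul, map_mul]
      ring)
    rw [hp, hq, norm_mul, norm_mul, Complex.norm_conj, ← mul_assoc]
    exact mul_le_mul_of_nonneg_right (hf.norm_wirtingerBar_le _ (hmaps hz)) (norm_nonneg _)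

theorem differentiableOn_comp (hf : IsQuasiconformalOn k f Ω) (hΩ : IsOpen Ω) (hΩ' : IsOpen Ω')
    (hA : DifferentiableOn ℂ A Ω') (hmaps : MapsTo f Ω Ω') :
    IsQuasiconformalOn k (A ∘ f) Ω where
  contDiffOn := ((hA.contDiffOn hΩ').restrict_scalars ℝ).comp hf.contDiffOn hmaps
  norm_wirtingerBar_le z hz := by
    have hAz : DifferentiableAt ℂ A (f z) := hA.differentiableAt (hΩ'.mem_nhds (hmaps hz))
    obtain ⟨hp, hq⟩ := wirtinger_eq_and_wirtingerBar_eq (f := A ∘ f) (z := z)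
        (p := deriv A (f z) * wirtinger f z) (q := deriv A (f z) * wirtingerBar f z) (by
      intro v
      rw [fderiv_comp z (hAz.restrictScalars ℝ) (hf.differentiableAt hΩ hz),
        hAz.fderiv_restrictScalars ℝ, ContinuousLinearMap.comp_apply,
        ContinuousLinearMap.coe_restrictScalars', fderiv_apply_eq_wirtinger f,
        fderiv_eq_smul_deriv, smul_eq_mul]
      ring)
    rw [hp, hq, norm_mul, norm_mul, mul_left_comm]
    exact mul_le_mul_of_nonneg_left (hf.norm_wirtingerBar_le z hz) (norm_nonneg _)

theorem lintegral_enorm_fderiv_sq_le (hf : IsQuasiconformalOn k f Ω) (hΩ : IsOpen Ω)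
    (hinj : InjOn f Ω) (hk0 : 0 ≤ k) (hk1 : k < 1) :
    ∫⁻ z in Ω, ‖fderiv ℝ f z‖ₑ ^ 2 ≤ ENNReal.ofReal ((1 + k) / (1 - k)) * volume (f '' Ω) := by
  have hK : 0 ≤ (1 + k) / (1 - k) := div_nonneg (by linarith) (by linarith)
  rw [← lintegral_abs_det_fderiv_eq_addHaar_image volume hΩ.measurableSet (fun z hz =>
    (hf.differentiableAt hΩ hz).hasFDerivAt.hasFDerivWithinAt) hinj,
    ← lintegral_const_mul' _ _ ENNReal.ofReal_ne_top]
  refine setLIntegral_mono' hΩ.measurableSet fun z hz => ?_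
  rw [← ofReal_norm, ← ENNReal.ofReal_pow (norm_nonneg _), ← ENNReal.ofReal_mul hK]
  refine ENNReal.ofReal_le_ofReal ((hf.norm_fderiv_sq_le hk1 hz).trans ?_)
  gcongr
  exact le_abs_self _

theorem sq_mul_log_le (hf : IsQuasiconformalOn k f Ω) (hΩ : IsOpen Ω) (hinj : InjOn f Ω)
    (hmaps : MapsTo f Ω unitDisc) (hk0 : 0 ≤ k) (hk1 : k < 1) {p : ℂ} {a b l : ℝ} (ha : 0 < a)
    (hab : a ≤ b) (hl : 0 ≤ l)
    (harc : ∀ r ∈ Ioo a b, ∃ s ∈ Icc (-Real.pi) Real.pi, ∃ t ∈ Icc (-Real.pi) Real.pi,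
      MapsTo (circleMap p r) (uIcc s t) Ω ∧
        l ≤ ‖f (circleMap p r s) - f (circleMap p r t)‖) :
    l ^ 2 * Real.log (b / a) ≤ 2 * Real.pi ^ 2 * ((1 + k) / (1 - k)) := by
  have hK : 0 ≤ (1 + k) / (1 - k) := div_nonneg (by linarith) (by linarith)
  have harea : volume (f '' Ω) ≤ ENNReal.ofReal Real.pi := by
    refine (measure_mono hmaps.image_subset).trans_eq ?_
    rw [unitDisc, Complex.volume_ball]
    rw [ENNReal.ofReal_one, one_pow, one_mul]
    exact (ENNReal.ofReal_eq_coe_nnreal Real.pi_pos.le).symm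
  have henergy := (ofReal_sq_mul_log_le_lintegral_enorm_fderiv_sq hΩ hf.contDiffOn ha hab hl
    harc).trans ((hf.lintegral_enorm_fderiv_sq_le hΩ hinj hk0 hk1).trans
      (mul_le_mul_right harea _))
  rw [← ENNReal.ofReal_mul hK, ENNReal.ofReal_le_ofReal_iff (by positivity), div_mul_eq_mul_div,
    div_le_iff₀ (by positivity)] at henergy
  linarith

end IsQuasiconformalOn

end Wirtinger

section PoincareDistance

theorem mem_unitDisc {z : ℂ} : z ∈ unitDisc ↔ ‖z‖ < 1 := mem_ball_zero_iff

theorem isOpen_unitDisc : IsOpen unitDisc := Metric.isOpen_ball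

theorem zero_mem_unitDisc : (0 : ℂ) ∈ unitDisc := Metric.mem_ball_self one_pos

theorem neg_mem_unitDisc {a : ℂ} (ha : a ∈ unitDisc) : -a ∈ unitDisc := by
  simpa only [mem_unitDisc, norm_neg] using ha

theorem one_sub_conj_mul_ne_zero {z w : ℂ} (hz : z ∈ unitDisc) (hw : w ∈ unitDisc) :
    1 - conj w * z ≠ 0 := by
  refine sub_ne_zero.2 fun h => ?_
  have hlt : ‖w‖ * ‖z‖ < 1 :=
    mul_lt_one_of_nonneg_of_lt_one_left (norm_nonneg w) (mem_unitDisc.1 hw) (mem_unitDisc.1 hz).le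
  rw [← Complex.norm_conj w, ← norm_mul, ← h, norm_one] at hlt
  exact lt_irrefl 1 hlt

theorem norm_one_sub_conj_mul_sq (z w : ℂ) :
    ‖1 - conj w * z‖ ^ 2 = ‖z - w‖ ^ 2 + (1 - ‖z‖ ^ 2) * (1 - ‖w‖ ^ 2) := by
  simp only [← Complex.normSq_eq_norm_sq, Complex.normSq_apply, Complex.sub_re, Complex.sub_im,
    Complex.one_re, Complex.one_im, Complex.mul_re, Complex.mul_im, Complex.conj_re,
    Complex.conj_im]
  ring

/-- The Möbius automorphism of the unit disc that sends `a` to `0`. By definition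
`poincareDist z w` is `artanh ‖moebius w z‖`. -/
noncomputable def moebius (a z : ℂ) : ℂ := (z - a) / (1 - conj a * z)

@[simp]
theorem moebius_self (a : ℂ) : moebius a a = 0 := by simp [moebius]

@[simp]
theorem moebius_neg_zero (a : ℂ) : moebius (-a) 0 = a := by simp [moebius]

theorem moebius_mem_unitDisc {a z : ℂ} (ha : a ∈ unitDisc) (hz : z ∈ unitDisc) :
    moebius a z ∈ unitDisc := by
  have hden := norm_pos_iff.2 (one_sub_conj_mul_ne_zero hz ha)
  rw [mem_unitDisc, moebius, norm_div, div_lt_one hden]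
  refine lt_of_pow_lt_pow_left₀ 2 hden.le ?_
  rw [norm_one_sub_conj_mul_sq, lt_add_iff_pos_right]
  exact mul_pos (sub_pos.2 (pow_lt_one₀ (norm_nonneg _) (mem_unitDisc.1 hz) two_ne_zero))
    (sub_pos.2 (pow_lt_one₀ (norm_nonneg _) (mem_unitDisc.1 ha) two_ne_zero))

theorem moebius_neg_moebius {a z : ℂ} (ha : a ∈ unitDisc) (hz : z ∈ unitDisc) :
    moebius (-a) (moebius a z) = z := by
  have hden := one_sub_conj_mul_ne_zero (moebius_mem_unitDisc ha hz) (neg_mem_unitDisc ha)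
  have hmul : moebius a z * (1 - conj a * z) = z - a :=
    div_mul_cancel₀ _ (one_sub_conj_mul_ne_zero hz ha)
  rw [moebius, div_eq_iff hden, map_neg]
  linear_combination hmul

theorem moebius_moebius_neg {a z : ℂ} (ha : a ∈ unitDisc) (hz : z ∈ unitDisc) :
    moebius a (moebius (-a) z) = z := by
  simpa only [neg_neg] using moebius_neg_moebius (neg_mem_unitDisc ha) hz

theorem differentiableOn_moebius {a : ℂ} (ha : a ∈ unitDisc) :
    DifferentiableOn ℂ (moebius a) unitDisc :=
  DifferentiableOn.div (by fun_prop) (by fun_prop) fun _ hz => one_sub_conj_mul_ne_zero hz ha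

/-- The Möbius automorphism `moebius a`, restricted to the unit disc so that it can be composed with
homeomorphisms of the disc. -/
noncomputable def moebiusHomeomorph (a : ℂ) (ha : a ∈ unitDisc) : OpenPartialHomeomorph ℂ ℂ where
  toFun := moebius a
  invFun := moebius (-a)
  source := unitDisc
  target := unitDisc
  map_source' _ hz := moebius_mem_unitDisc ha hz
  map_target' _ hz := moebius_mem_unitDisc (neg_mem_unitDisc ha) hz
  left_inv' _ hz := moebius_neg_moebius ha hz
  right_inv' _ hz := moebius_moebius_neg ha hz
  open_source := isOpen_unitDisc
  open_target := isOpen_unitDisc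
  continuousOn_toFun := (differentiableOn_moebius ha).continuousOn
  continuousOn_invFun := (differentiableOn_moebius (neg_mem_unitDisc ha)).continuousOn

theorem poincareDist_nonneg (z w : ℂ) : 0 ≤ poincareDist z w :=
  Real.artanh_nonneg (norm_nonneg _)

theorem poincareDist_comm (z w : ℂ) : poincareDist z w = poincareDist w z := by
  rw [poincareDist, poincareDist, norm_div, norm_div, norm_sub_rev z w,
    ← Complex.norm_conj (1 - conj w * z)]
  simp only [map_sub, map_one, map_mul, Complex.conj_conj, mul_comm w]

@[simp]
theorem poincareDist_zero_left (z : ℂ) : poincareDist 0 z = Real.artanh ‖z‖ := by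
  simp [poincareDist]

theorem poincareDist_le_artanh_iff {z w : ℂ} (hz : z ∈ unitDisc) (hw : w ∈ unitDisc) {a : ℝ}
    (ha : a ∈ Ioo 0 1) : poincareDist z w ≤ Real.artanh a ↔ ‖moebius w z‖ ≤ a :=
  Real.artanh_le_artanh_iff
    ⟨neg_one_lt_zero.trans_le (norm_nonneg _), mem_unitDisc.1 (moebius_mem_unitDisc hw hz)⟩
    ⟨neg_one_lt_zero.trans ha.1, ha.2⟩

theorem poincareDist_moebius {a z w : ℂ} (ha : a ∈ unitDisc) (hz : z ∈ unitDisc)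
    (hw : w ∈ unitDisc) : poincareDist (moebius a z) (moebius a w) = poincareDist z w := by
  have hza := one_sub_conj_mul_ne_zero hz ha
  have hwa := one_sub_conj_mul_ne_zero hw ha
  have hwa' : 1 - a * conj w ≠ 0 := by simpa using (map_ne_zero (starRingEnd ℂ)).2 hwa
  have haa := one_sub_conj_mul_ne_zero ha ha
  have hnum : moebius a z - moebius a w
      = (1 - conj a * a) * (z - w) / ((1 - conj a * z) * (1 - conj a * w)) := by
    rw [moebius, moebius, div_sub_div _ _ hza hwa]
    congr 1
    ring
  have hden : 1 - conj (moebius a w) * moebius a z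
      = (1 - conj a * a) * (1 - conj w * z) / ((1 - a * conj w) * (1 - conj a * z)) := by
    simp only [moebius, map_div₀, map_sub, map_one, map_mul, Complex.conj_conj]
    rw [div_mul_div_comm, one_sub_div (mul_ne_zero hwa' hza)]
    congr 1
    ring
  have hquot : (moebius a z - moebius a w) / (1 - conj (moebius a w) * moebius a z)
      = (z - w) / (1 - conj w * z) * ((1 - a * conj w) / (1 - conj a * w)) := by
    rw [hnum, hden]
    field_simp
  have hunimodular : ‖(1 - a * conj w) / (1 - conj a * w)‖ = 1 := by
    rw [norm_div, ← Complex.norm_conj (1 - a * conj w)]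
    simp only [map_sub, map_one, map_mul, Complex.conj_conj]
    exact div_self (norm_ne_zero_iff.2 hwa)
  rw [poincareDist, hquot, norm_mul, hunimodular, mul_one, poincareDist]

theorem artanh_neg_eq {a : ℝ} (ha : a ∈ Ioo (-1) 1) : Real.artanh (-a) = -Real.artanh a := by
  rw [Real.artanh_eq_half_log (Ioo_subset_Icc_self ha),
    Real.artanh_eq_half_log (Ioo_subset_Icc_self (by simpa [and_comm, neg_lt] using ha)),
    ← mul_neg, ← Real.log_inv, inv_div, sub_neg_eq_add, sub_eq_add_neg]

theorem artanh_add_artanh {a b : ℝ} (ha : a ∈ Ioo (-1) 1) (hb : b ∈ Ioo (-1) 1) :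
    Real.artanh a + Real.artanh b = Real.artanh ((a + b) / (1 + a * b)) := by
  have hpos : 0 < (1 + a) * (1 + b) := mul_pos (by linarith [ha.1]) (by linarith [hb.1])
  have hpos' : 0 < (1 - a) * (1 - b) := mul_pos (by linarith [ha.2]) (by linarith [hb.2])
  have hden : 0 < 1 + a * b := by linarith
  have hmem : (a + b) / (1 + a * b) ∈ Icc (-1 : ℝ) 1 :=
    ⟨by rw [le_div_iff₀ hden]; linarith, by rw [div_le_one hden]; linarith⟩
  rw [Real.artanh_eq_half_log (Ioo_subset_Icc_self ha),
    Real.artanh_eq_half_log (Ioo_subset_Icc_self hb), Real.artanh_eq_half_log hmem, ← mul_add,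
    ← Real.log_mul (div_pos (by linarith [ha.1]) (by linarith [ha.2])).ne'
      (div_pos (by linarith [hb.1]) (by linarith [hb.2])).ne', div_mul_div_comm,
    one_add_div hden.ne', one_sub_div hden.ne', div_div_div_cancel_right₀ hden.ne']
  ring_nf

theorem poincareDist_le_artanh_norm_add {z w : ℂ} (hz : z ∈ unitDisc) (hw : w ∈ unitDisc) :
    poincareDist z w ≤ Real.artanh ‖z‖ + Real.artanh ‖w‖ := by
  have hz1 := mem_unitDisc.1 hz
  have hw1 := mem_unitDisc.1 hw
  have hz0 := norm_nonneg z
  have hw0 := norm_nonneg w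
  have hpos : 0 < 1 + ‖z‖ * ‖w‖ := by positivity
  have hden := norm_pos_iff.2 (one_sub_conj_mul_ne_zero hz hw)
  rw [artanh_add_artanh ⟨by linarith, hz1⟩ ⟨by linarith, hw1⟩]
  refine Real.artanh_le_artanh (by linarith [norm_nonneg ((z - w) / (1 - conj w * z))]) ?_ ?_
  · rw [div_lt_one hpos]
    nlinarith
  rw [norm_div, div_le_div_iff₀ hden hpos]
  refine le_of_sq_le_sq ?_ (by positivity)
  have hle : ‖1 - conj w * z‖ ^ 2 ≤ (1 + ‖z‖ * ‖w‖) ^ 2 := by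
    gcongr
    exact (norm_sub_le _ _).trans_eq (by simp [mul_comm])
  have hnonneg : 0 ≤ (1 - ‖z‖ ^ 2) * (1 - ‖w‖ ^ 2) := mul_nonneg (by nlinarith) (by nlinarith)
  rw [mul_pow, mul_pow, eq_sub_of_add_eq (norm_one_sub_conj_mul_sq z w).symm]
  linear_combination mul_le_mul_of_nonneg_left hle hnonneg

theorem poincareDist_triangle {x y z : ℂ} (hx : x ∈ unitDisc) (hy : y ∈ unitDisc)
    (hz : z ∈ unitDisc) : poincareDist x z ≤ poincareDist x y + poincareDist y z := by
  have h := poincareDist_le_artanh_norm_add (moebius_mem_unitDisc hy hx)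
    (moebius_mem_unitDisc hy hz)
  rwa [poincareDist_moebius hy hx hz, ← poincareDist_zero_left, ← poincareDist_zero_left,
    ← moebius_self y, poincareDist_moebius hy hy hx, poincareDist_moebius hy hy hz,
    poincareDist_comm y x] at h

theorem poincareDist_ofReal_mul {u : ℂ} (hu : ‖u‖ = 1) {a b : ℝ} (ha : a ∈ Ioo (-1) 1)
    (hb : b ∈ Ioo (-1) 1) (hba : b ≤ a) :
    poincareDist (a * u) (b * u) = Real.artanh a - Real.artanh b := by
  have hden : 0 < 1 - a * b := by nlinarith [ha.1, ha.2, hb.1, hb.2]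
  have hconj : conj u * u = 1 := by
    rw [← Complex.normSq_eq_conj_mul_self, Complex.normSq_eq_norm_sq, hu, one_pow,
      Complex.ofReal_one]
  have hquot : ((a : ℂ) * u - b * u) / (1 - conj ((b : ℂ) * u) * (a * u))
      = ((a - b) / (1 - a * b) : ℝ) * u := by
    have : 1 - conj ((b : ℂ) * u) * (a * u) = (1 - a * b : ℝ) := by
      rw [map_mul, Complex.conj_ofReal]
      push_cast
      linear_combination (-(a * b) : ℂ) * hconj
    rw [this]
    push_cast
    ring
  rw [sub_eq_add_neg, ← artanh_neg_eq hb,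
    artanh_add_artanh ha (by simpa [and_comm, neg_lt] using hb), poincareDist, hquot, norm_mul, hu,
    mul_one, Complex.norm_real, Real.norm_of_nonneg (div_nonneg (by linarith) hden.le), mul_neg,
    ← sub_eq_add_neg, ← sub_eq_add_neg]

theorem exists_mem_unitDisc_poincareDist_zero_eq {v : ℂ} (hv : v ∈ unitDisc) {s : ℝ}
    (hs0 : 0 ≤ s) (hs : s ≤ poincareDist 0 v) :
    ∃ m ∈ unitDisc, poincareDist 0 m = s ∧ poincareDist m v = poincareDist 0 v - s := by
  obtain ⟨a, ha, rfl⟩ := Real.artanh_surjOn (mem_univ s)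
  rw [poincareDist_zero_left] at hs ⊢
  have hv1 : ‖v‖ ∈ Ioo (-1 : ℝ) 1 := ⟨by linarith [norm_nonneg v], mem_unitDisc.1 hv⟩
  have ha0 : 0 ≤ a := (Real.artanh_le_artanh_iff (by norm_num) ha).1 (by rwa [Real.artanh_zero])
  have hav : a ≤ ‖v‖ := (Real.artanh_le_artanh_iff ha hv1).1 hs
  set u := Complex.exp (v.arg * Complex.I)
  have hu : ‖u‖ = 1 := Complex.norm_exp_ofReal_mul_I _
  have hnorm : ‖(a : ℂ) * u‖ = a := by
    rw [norm_mul, hu, mul_one, Complex.norm_real, Real.norm_of_nonneg ha0]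
  refine ⟨a * u, mem_unitDisc.2 (hnorm.trans_lt ha.2), ?_, ?_⟩
  · rw [poincareDist_zero_left, hnorm]
  · rw [poincareDist_comm, ← poincareDist_ofReal_mul hu hv1 ha hav,
      Complex.norm_mul_exp_arg_mul_I]

theorem exists_mem_unitDisc_poincareDist_eq {x y : ℂ} (hx : x ∈ unitDisc) (hy : y ∈ unitDisc)
    {s : ℝ} (hs0 : 0 ≤ s) (hs : s ≤ poincareDist x y) :
    ∃ m ∈ unitDisc, poincareDist x m = s ∧ poincareDist m y = poincareDist x y - s := by
  rw [← poincareDist_moebius hx hx hy, moebius_self] at hs ⊢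
  obtain ⟨m, hm, h0m, hmy⟩ :=
    exists_mem_unitDisc_poincareDist_zero_eq (moebius_mem_unitDisc hx hy) hs0 hs
  have hm' := moebius_mem_unitDisc (neg_mem_unitDisc hx) hm
  refine ⟨moebius (-x) m, hm', ?_, ?_⟩
  · rw [← poincareDist_moebius hx hx hm', moebius_self, moebius_moebius_neg hx hm, h0m]
  · rw [← poincareDist_moebius hx hm' hy, moebius_moebius_neg hx hm, hmy]

end PoincareDistance

section CoarseGeometry

variable {X Y : Type*} {d : X → X → ℝ} {d' : Y → Y → ℝ} {S : Set X} {T : Set Y} {f : X → Y}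

/-- Induction on the number of steps of length `δ` into which the way from `x` to `y` is cut. -/
theorem le_div_mul_add_of_bounded_at_scale {δ C : ℝ} (hδ : 0 < δ) (hC : 0 ≤ C)
    (hd : ∀ x y, 0 ≤ d x y)
    (hbetween : ∀ x ∈ S, ∀ y ∈ S, δ ≤ d x y → ∃ m ∈ S, d x m = δ ∧ d m y = d x y - δ)
    (htriangle : ∀ x ∈ T, ∀ y ∈ T, ∀ z ∈ T, d' x z ≤ d' x y + d' y z) (hmaps : MapsTo f S T)
    (hbounded : ∀ x ∈ S, ∀ y ∈ S, d x y ≤ δ → d' (f x) (f y) ≤ C) :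
    ∀ x ∈ S, ∀ y ∈ S, d' (f x) (f y) ≤ C / δ * d x y + C := by
  have hsteps : ∀ n : ℕ, ∀ x ∈ S, ∀ y ∈ S, d x y ≤ (n + 1) * δ →
      d' (f x) (f y) ≤ (n + 1) * C := by
    intro n
    induction n with
    | zero => exact fun x hx y hy hxy => by simpa using hbounded x hx y hy (by simpa using hxy)
    | succ n ih =>
      intro x hx y hy hxy
      push_cast at hxy ⊢
      rcases le_or_gt (d x y) δ with hle | hlt
      · nlinarith [hbounded x hx y hy hle, mul_nonneg (Nat.cast_nonneg (α := ℝ) n) hC]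
      · obtain ⟨m, hm, hxm, hmy⟩ := hbetween x hx y hy hlt.le
        have hfxm := hbounded x hx m hm hxm.le
        have hfmy := ih m hm y hy (by linarith)
        have := htriangle _ (hmaps hx) _ (hmaps hm) _ (hmaps hy)
        linarith
  intro x hx y hy
  calc d' (f x) (f y) ≤ (⌊d x y / δ⌋₊ + 1) * C :=
        hsteps _ x hx y hy ((div_le_iff₀ hδ).1 (Nat.lt_floor_add_one _).le)
    _ ≤ (d x y / δ + 1) * C := by
        gcongr
        exact Nat.floor_le (div_nonneg (hd x y) hδ.le)
    _ = C / δ * d x y + C := by ring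

theorem isQuasiIsometryOnWith_max {L L' c : ℝ} (hL' : 0 < L') (hd : ∀ x y, 0 ≤ d x y)
    (hupper : ∀ x ∈ S, ∀ y ∈ S, d' (f x) (f y) ≤ L * d x y + c)
    (hlower : ∀ x ∈ S, ∀ y ∈ S, d x y ≤ L' * (d' (f x) (f y) + c)) :
    IsQuasiIsometryOnWith d d' (max L L') c f S := by
  intro x hx y hy
  constructor
  · calc 1 / max L L' * d x y - c ≤ 1 / L' * d x y - c := by
          gcongr
          · exact hd x y
          · exact le_max_right L L'
      _ ≤ d' (f x) (f y) := by
          rw [sub_le_iff_le_add, one_div_mul_eq_div, div_le_iff₀' hL']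
          exact hlower x hx y hy
  · refine (hupper x hx y hy).trans ?_
    gcongr
    · exact hd x y
    · exact le_max_left L L'

end CoarseGeometry

section DiscHomeomorphisms

theorem poincareDist_apply_le_div_mul_add {f : ℂ → ℂ} (hf : MapsTo f unitDisc unitDisc)
    {δ C : ℝ} (hδ : 0 < δ) (hC : 0 ≤ C)
    (hbounded : ∀ x ∈ unitDisc, ∀ y ∈ unitDisc, poincareDist x y ≤ δ →
      poincareDist (f x) (f y) ≤ C) :
    ∀ x ∈ unitDisc, ∀ y ∈ unitDisc,
      poincareDist (f x) (f y) ≤ C / δ * poincareDist x y + C :=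
  le_div_mul_add_of_bounded_at_scale hδ hC poincareDist_nonneg
    (fun _ hx _ hy => exists_mem_unitDisc_poincareDist_eq hx hy hδ.le)
    (fun _ hx _ hy _ hz => poincareDist_triangle hx hy hz) hf hbounded

theorem exists_first_hitting {φ : ℝ → ℝ} (hφ : Continuous φ) {a b s : ℝ} (ha : φ a ≤ s)
    (hb : s ≤ φ b) : ∃ t ∈ uIcc a b, φ t = s ∧ ∀ x ∈ uIcc a t, φ x ≤ s := by
  wlog hab : a ≤ b generalizing φ a b
  · obtain ⟨t, ht, hts, hle⟩ := this (φ := φ ∘ Neg.neg) (a := -a) (b := -b)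
      (hφ.comp continuous_neg) (by simpa using ha) (by simpa using hb) (by linarith)
    have hneg : ∀ c y : ℝ, y ∈ uIcc a c ↔ -y ∈ uIcc (-a) (-c) := by
      simp [mem_uIcc, and_comm, or_comm]
    refine ⟨-t, (hneg _ _).2 (by rwa [neg_neg]), hts, fun x hx => ?_⟩
    simpa using hle (-x) (by simpa using (hneg _ _).1 hx)
  have hcompact : IsCompact (Icc a b ∩ φ ⁻¹' Ici s) :=
    isCompact_Icc.inter_right (isClosed_Ici.preimage hφ)
  obtain ⟨t, ⟨ht, hst⟩, hmin⟩ := hcompact.exists_isLeast ⟨b, right_mem_Icc.2 hab, hb⟩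
  have hlt : ∀ x ∈ Ico a t, φ x < s := fun x hx => by
    by_contra! hsx
    exact (hmin ⟨⟨hx.1, hx.2.le.trans ht.2⟩, hsx⟩).not_gt hx.2
  have hts : φ t = s := by
    obtain ⟨x, hx, rfl⟩ := intermediate_value_Icc ht.1 hφ.continuousOn ⟨ha, hst⟩
    rcases hx.2.eq_or_lt with rfl | hxt
    · rfl
    · exact absurd (hlt x ⟨hx.1, hxt⟩) (lt_irrefl _)
  refine ⟨t, uIcc_of_le hab ▸ ht, hts, fun x hx => ?_⟩
  rw [uIcc_of_le ht.1] at hx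
  rcases hx.2.eq_or_lt with rfl | hxt
  · exact hts.le
  · exact (hlt x ⟨hx.1, hxt⟩).le

theorem circleMap_arg_sub {p ζ : ℂ} {r : ℝ} (h : ‖ζ - p‖ = r) :
    circleMap p r (ζ - p).arg = ζ := by
  rw [circleMap, ← h, Complex.norm_mul_exp_arg_mul_I, add_sub_cancel]

theorem norm_circleMap_arg_self {u : ℂ} (hu : ‖u‖ = 1) {r : ℝ} (hr : 0 ≤ r) :
    ‖circleMap u r u.arg‖ = 1 + r := by
  have h : circleMap u r u.arg = (1 + r : ℝ) * u := by
    have hexp := Complex.norm_mul_exp_arg_mul_I u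
    rw [hu, Complex.ofReal_one, one_mul] at hexp
    rw [circleMap, hexp]
    push_cast
    ring
  rw [h, norm_mul, hu, mul_one, Complex.norm_real, Real.norm_of_nonneg (by positivity)]

theorem exists_forall_lt_norm_apply {e : OpenPartialHomeomorph ℂ ℂ} (hs : e.source = unitDisc)
    (ht : e.target = unitDisc) {r : ℝ} (hr : r < 1) :
    ∃ ρ < 1, ∀ z ∈ unitDisc, ρ < ‖z‖ → r < ‖e z‖ := by
  have hball : Metric.closedBall 0 r ⊆ unitDisc := Metric.closedBall_subset_ball hr
  have hcompact : IsCompact (e.symm '' Metric.closedBall 0 r) :=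
    (isCompact_closedBall 0 r).image_of_continuousOn (e.continuousOn_symm.mono (ht ▸ hball))
  have hsub : e.symm '' Metric.closedBall 0 r ⊆ unitDisc :=
    image_subset_iff.2 fun z hz => hs ▸ e.map_target (ht ▸ hball hz)
  obtain ⟨ρ, hρ, hsubρ⟩ := exists_lt_subset_ball hcompact.isClosed hsub
  refine ⟨ρ, hρ, fun z hz hρz => ?_⟩
  by_contra! hle
  have hmem := hsubρ ⟨e z, mem_closedBall_zero_iff.2 hle, e.left_inv (hs ▸ hz)⟩
  exact hρz.not_gt (mem_ball_zero_iff.1 hmem)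

theorem exists_norm_eq_and_apply_eq_ofReal_mul {e : OpenPartialHomeomorph ℂ ℂ}
    (hs : e.source = unitDisc) (ht : e.target = unitDisc) {u z : ℂ} (hu : ‖u‖ = 1) {t₀ r : ℝ}
    (ht₀ : 0 ≤ t₀) (hz : z ∈ unitDisc) (hez : e z = t₀ * u) (hzr : ‖z‖ ≤ r) (hr : r < 1) :
    ∃ ζ, ‖ζ‖ = r ∧ ∃ t, t₀ ≤ t ∧ e ζ = t * u := by
  obtain ⟨ρ, hρ, hproper⟩ := exists_forall_lt_norm_apply (e := e.symm) ht hs hr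
  have hnorm : ∀ t : ℝ, 0 ≤ t → ‖(t : ℂ) * u‖ = t := fun t ht => by
    rw [norm_mul, hu, mul_one, Complex.norm_real, Real.norm_of_nonneg ht]
  have ht₀1 : t₀ < 1 := by
    rw [← hnorm t₀ ht₀, ← hez, ← mem_unitDisc]
    exact ht ▸ e.map_source (hs ▸ hz)
  obtain ⟨t₁, ht₁, ht₁1⟩ := exists_between (max_lt ht₀1 hρ)
  have ht₀₁ : t₀ ≤ t₁ := (le_max_left _ _).trans ht₁.le
  have hmem : ∀ t ∈ Icc t₀ t₁, (t : ℂ) * u ∈ unitDisc := fun t ht =>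
    mem_unitDisc.2 ((hnorm t (ht₀.trans ht.1)).trans_lt (ht.2.trans_lt ht₁1))
  have hcont : ContinuousOn (fun t : ℝ => ‖e.symm (t * u)‖) (Icc t₀ t₁) :=
    (e.continuousOn_symm.comp (by fun_prop) fun t h => ht ▸ hmem t h).norm
  have hstart : ‖e.symm (t₀ * u)‖ ≤ r := by rwa [← hez, e.left_inv (hs ▸ hz)]
  have hend : r < ‖e.symm (t₁ * u)‖ := hproper _ (hmem t₁ (right_mem_Icc.2 ht₀₁))
    ((le_max_right _ _).trans_lt (ht₁.trans_eq (hnorm t₁ (ht₀.trans ht₀₁)).symm))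
  obtain ⟨t, htI, htr⟩ := intermediate_value_Icc ht₀₁ hcont ⟨hstart, hend.le⟩
  exact ⟨e.symm (t * u), htr, t, htI.1, e.right_inv (ht ▸ hmem t htI)⟩

/-- The `k`-quasiconformal homeomorphisms of the unit disc onto itself, encoded as partial
homeomorphisms of `ℂ`. -/
structure IsQuasiconformalDiscHomeo (k : ℝ) (f : OpenPartialHomeomorph ℂ ℂ) : Prop where
  source_eq : f.source = unitDisc
  target_eq : f.target = unitDisc
  isQuasiconformalOn : IsQuasiconformalOn k f unitDisc

namespace IsQuasiconformalDiscHomeo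

variable {k : ℝ} {f : OpenPartialHomeomorph ℂ ℂ} {z w : ℂ}

theorem mapsTo (hf : IsQuasiconformalDiscHomeo k f) : MapsTo f unitDisc unitDisc := fun _ hz =>
  hf.target_eq ▸ f.map_source (hf.source_eq ▸ hz)

theorem mapsTo_symm (hf : IsQuasiconformalDiscHomeo k f) : MapsTo f.symm unitDisc unitDisc :=
  fun _ hz => hf.source_eq ▸ f.map_target (hf.target_eq ▸ hz)

theorem left_inv (hf : IsQuasiconformalDiscHomeo k f) (hz : z ∈ unitDisc) : f.symm (f z) = z :=
  f.left_inv (hf.source_eq ▸ hz)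

theorem right_inv (hf : IsQuasiconformalDiscHomeo k f) (hz : z ∈ unitDisc) : f (f.symm z) = z :=
  f.right_inv (hf.target_eq ▸ hz)

theorem injOn (hf : IsQuasiconformalDiscHomeo k f) : InjOn f unitDisc := hf.source_eq ▸ f.injOn

theorem moebius_trans (hf : IsQuasiconformalDiscHomeo k f) {a b : ℂ} (ha : a ∈ unitDisc)
    (hb : b ∈ unitDisc) :
    IsQuasiconformalDiscHomeo k (((moebiusHomeomorph a ha).trans' f hf.source_eq.symm).trans'
      (moebiusHomeomorph b hb) hf.target_eq) where
  source_eq := rfl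
  target_eq := rfl
  isQuasiconformalOn :=
    (hf.isQuasiconformalOn.comp_differentiableOn isOpen_unitDisc isOpen_unitDisc
      (differentiableOn_moebius ha) fun _ => moebius_mem_unitDisc ha).differentiableOn_comp
        isOpen_unitDisc isOpen_unitDisc (differentiableOn_moebius hb)
          fun _ hz => hf.mapsTo (moebius_mem_unitDisc ha hz)

theorem exists_recentred (hf : IsQuasiconformalDiscHomeo k f) (hw : w ∈ unitDisc) :
    ∃ g, IsQuasiconformalDiscHomeo k g ∧ g 0 = 0 ∧
      ∀ z ∈ unitDisc, g (moebius w z) = moebius (f w) (f z) := by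
  refine ⟨_, hf.moebius_trans (neg_mem_unitDisc hw) (hf.mapsTo hw), ?_, fun z hz => ?_⟩
  · change moebius (f w) (f (moebius (-w) 0)) = 0
    rw [moebius_neg_zero, moebius_self]
  · change moebius (f w) (f (moebius (-w) (moebius w z))) = _
    rw [moebius_neg_moebius hw hz]

/-- Length–area on the circles centred at `0`. The image of such a circle separates `0` and `f z`
from the boundary of the disc, so it meets the ray from `f z` outwards and the opposite ray, at
points at distance at least `‖f z‖`. -/
theorem norm_apply_sq_mul_log_le (hf : IsQuasiconformalDiscHomeo k f) (hk0 : 0 ≤ k) (hk1 : k < 1)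
    (hf0 : f 0 = 0) (hz : z ∈ unitDisc) (hz0 : z ≠ 0) :
    ‖f z‖ ^ 2 * Real.log (1 / ‖z‖) ≤ 2 * Real.pi ^ 2 * ((1 + k) / (1 - k)) := by
  refine hf.isQuasiconformalOn.sq_mul_log_le isOpen_unitDisc hf.injOn hf.mapsTo hk0 hk1 (p := 0)
    (norm_pos_iff.2 hz0) (mem_unitDisc.1 hz).le (norm_nonneg _) fun r hr => ?_
  set u := Complex.exp ((f z).arg * Complex.I)
  have hu : ‖u‖ = 1 := Complex.norm_exp_ofReal_mul_I _
  obtain ⟨ζ, hζ, t, hzt, hfζ⟩ := exists_norm_eq_and_apply_eq_ofReal_mul hf.source_eq hf.target_eq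
    hu (norm_nonneg (f z)) hz (Complex.norm_mul_exp_arg_mul_I _).symm hr.1.le hr.2
  obtain ⟨ξ, hξ, t', ht', hfξ⟩ := exists_norm_eq_and_apply_eq_ofReal_mul hf.source_eq hf.target_eq
    ((norm_neg u).trans hu) le_rfl zero_mem_unitDisc (by simp [hf0])
    (norm_zero.trans_le ((norm_nonneg z).trans hr.1.le)) hr.2
  refine ⟨_, Ioc_subset_Icc_self (Complex.arg_mem_Ioc (ζ - 0)), _,
    Ioc_subset_Icc_self (Complex.arg_mem_Ioc (ξ - 0)), fun x _ => ?_, ?_⟩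
  · rw [mem_unitDisc, norm_circleMap_zero, abs_of_nonneg ((norm_nonneg z).trans hr.1.le)]
    exact hr.2
  · have hsub : f ζ - f ξ = (t + t' : ℝ) * u := by
      rw [hfζ, hfξ]
      push_cast
      ring
    rw [circleMap_arg_sub (by rwa [sub_zero]), circleMap_arg_sub (by rwa [sub_zero]), hsub,
      norm_mul, hu, mul_one, Complex.norm_real]
    linarith [le_abs_self (t + t'), Real.norm_eq_abs (t + t')]

theorem exists_norm_sub_eq_and_norm_apply_le (hf : IsQuasiconformalDiscHomeo k f) (hf0 : f 0 = 0)
    (hz : z ∈ unitDisc) {p : ℂ} {r : ℝ} (hzr : ‖z - p‖ ≤ r) (hrp : r ≤ ‖p‖) :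
    ∃ ζ ∈ unitDisc, ‖ζ - p‖ = r ∧ ‖f ζ‖ ≤ ‖f z‖ := by
  have hnorm : ∀ t ∈ Icc (0 : ℝ) 1, ‖(t : ℂ) * f z‖ ≤ ‖f z‖ := fun t ht => by
    rw [norm_mul, Complex.norm_real, Real.norm_of_nonneg ht.1]
    exact mul_le_of_le_one_left (norm_nonneg _) ht.2
  have hmem : ∀ t ∈ Icc (0 : ℝ) 1, (t : ℂ) * f z ∈ unitDisc := fun t ht =>
    mem_unitDisc.2 ((hnorm t ht).trans_lt (mem_unitDisc.1 (hf.mapsTo hz)))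
  have hcont : ContinuousOn (fun t : ℝ => ‖f.symm (t * f z) - p‖) (Icc 0 1) :=
    ((f.continuousOn_symm.comp (by fun_prop) fun t ht => hf.target_eq ▸ hmem t ht).sub
      continuousOn_const).norm
  have hzero : f.symm 0 = 0 := by simpa only [hf0] using hf.left_inv zero_mem_unitDisc
  obtain ⟨t, ht, htr⟩ := intermediate_value_Icc' zero_le_one hcont (show r ∈ Icc _ _ by
    simpa [hzero, hf.left_inv hz] using ⟨hzr, hrp⟩)
  refine ⟨f.symm (t * f z), hf.mapsTo_symm (hmem t ht), htr, ?_⟩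
  rw [hf.right_inv (hmem t ht)]
  exact hnorm t ht

theorem exists_arc_lt_norm_apply (hf : IsQuasiconformalDiscHomeo k f) {u : ℂ} (hu : ‖u‖ = 1)
    {r φ M : ℝ} (hr : 0 ≤ r) (hφ : circleMap u r φ ∈ unitDisc) (hM : M < 1) :
    ∃ t ∈ uIcc φ u.arg, MapsTo (circleMap u r) (uIcc φ t) unitDisc ∧
      M < ‖f (circleMap u r t)‖ := by
  obtain ⟨ρ, hρ, hproper⟩ := exists_forall_lt_norm_apply hf.source_eq hf.target_eq hM
  obtain ⟨s, hs, hs1⟩ := exists_between (max_lt (mem_unitDisc.1 hφ) hρ)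
  have hend : s ≤ ‖circleMap u r u.arg‖ := by
    rw [norm_circleMap_arg_self hu hr]
    linarith
  obtain ⟨t, ht, hts, hle⟩ := exists_first_hitting (continuous_circleMap u r).norm
    ((le_max_left _ _).trans hs.le) hend
  refine ⟨t, ht, fun x hx => mem_unitDisc.2 ((hle x hx).trans_lt hs1), ?_⟩
  exact hproper _ (mem_unitDisc.2 (hts.trans_lt hs1)) (hts ▸ (le_max_right _ _).trans_lt hs)

/-- Length–area on the circles centred at the boundary point `u = z / ‖z‖`. Such a circle of radius
between `‖z - u‖` and `‖0 - u‖` meets the preimage of the segment from `0` to `f z`, where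
`‖f‖ ≤ 1 / 2`; followed up to the boundary of the disc, it reaches points where `‖f‖ > 3 / 4`. -/
theorem sq_mul_log_one_div_one_sub_norm_le (hf : IsQuasiconformalDiscHomeo k f) (hk0 : 0 ≤ k)
    (hk1 : k < 1) (hf0 : f 0 = 0) (hz : z ∈ unitDisc) (hfz : ‖f z‖ ≤ 1 / 2) :
    (1 / 4) ^ 2 * Real.log (1 / (1 - ‖z‖)) ≤ 2 * Real.pi ^ 2 * ((1 + k) / (1 - k)) := by
  set u := Complex.exp (z.arg * Complex.I)
  have hu : ‖u‖ = 1 := Complex.norm_exp_ofReal_mul_I _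
  have hzu : ‖z - u‖ = 1 - ‖z‖ := by
    have h : z - u = (‖z‖ - 1 : ℝ) * u := by
      nth_rw 1 [← Complex.norm_mul_exp_arg_mul_I z]
      push_cast
      ring
    rw [h, norm_mul, hu, mul_one, Complex.norm_real, ← norm_neg, neg_sub,
      Real.norm_of_nonneg (sub_nonneg.2 (mem_unitDisc.1 hz).le)]
  refine hf.isQuasiconformalOn.sq_mul_log_le isOpen_unitDisc hf.injOn hf.mapsTo hk0 hk1 (p := u)
    (sub_pos.2 (mem_unitDisc.1 hz)) (sub_le_self 1 (norm_nonneg z)) (by norm_num) fun r hr => ?_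
  obtain ⟨ζ, hζ, hζr, hfζ⟩ :=
    hf.exists_norm_sub_eq_and_norm_apply_le hf0 hz (hzu.trans_le hr.1.le) (hr.2.le.trans_eq hu.symm)
  have hcircle := circleMap_arg_sub hζr
  have harg : (ζ - u).arg ∈ Icc (-Real.pi) Real.pi := Ioc_subset_Icc_self (Complex.arg_mem_Ioc _)
  obtain ⟨t, ht, hmaps, hft⟩ := hf.exists_arc_lt_norm_apply hu (hζr ▸ norm_nonneg _)
    (hcircle.symm ▸ hζ) (show (3 / 4 : ℝ) < 1 by norm_num)
  refine ⟨_, harg, t, uIcc_subset_Icc harg (Ioc_subset_Icc_self (Complex.arg_mem_Ioc u)) ht,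
    hmaps, ?_⟩
  rw [hcircle, norm_sub_rev]
  linarith [norm_sub_norm_le (f (circleMap u r t)) (f ζ)]

theorem norm_apply_le_half (hf : IsQuasiconformalDiscHomeo k f) (hk0 : 0 ≤ k) (hk1 : k < 1)
    (hf0 : f 0 = 0) (hz : z ∈ unitDisc)
    (hzr : ‖z‖ ≤ Real.exp (-(8 * Real.pi ^ 2 * ((1 + k) / (1 - k))))) : ‖f z‖ ≤ 1 / 2 := by
  rcases eq_or_ne z 0 with rfl | hz0
  · norm_num [hf0]
  have : 0 < (1 + k) / (1 - k) := div_pos (by linarith) (by linarith)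
  have hlog : 8 * Real.pi ^ 2 * ((1 + k) / (1 - k)) ≤ Real.log (1 / ‖z‖) := by
    rw [one_div, Real.log_inv, le_neg]
    exact (Real.log_le_iff_le_exp (norm_pos_iff.2 hz0)).2 hzr
  have hest := (mul_le_mul_of_nonneg_left hlog (sq_nonneg ‖f z‖)).trans
    (hf.norm_apply_sq_mul_log_le hk0 hk1 hf0 hz hz0)
  refine abs_le_of_sq_le_sq' ?_ (by norm_num) |>.2
  have : 0 < 8 * Real.pi ^ 2 * ((1 + k) / (1 - k)) := by positivity
  nlinarith

theorem norm_le_of_norm_apply_le_half (hf : IsQuasiconformalDiscHomeo k f) (hk0 : 0 ≤ k)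
    (hk1 : k < 1) (hf0 : f 0 = 0) (hz : z ∈ unitDisc) (hfz : ‖f z‖ ≤ 1 / 2) :
    ‖z‖ ≤ 1 - Real.exp (-(32 * Real.pi ^ 2 * ((1 + k) / (1 - k)))) := by
  have hest := hf.sq_mul_log_one_div_one_sub_norm_le hk0 hk1 hf0 hz hfz
  rw [one_div (1 - ‖z‖), Real.log_inv] at hest
  have hexp := (Real.le_log_iff_exp_le (sub_pos.2 (mem_unitDisc.1 hz))).1
    (show -(32 * Real.pi ^ 2 * ((1 + k) / (1 - k))) ≤ Real.log (1 - ‖z‖) by linarith)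
  linarith

theorem exists_pos_forall_poincareDist_apply_le (hk0 : 0 ≤ k) (hk1 : k < 1) :
    ∃ δ > 0, ∀ f, IsQuasiconformalDiscHomeo k f → ∀ z ∈ unitDisc, ∀ w ∈ unitDisc,
      poincareDist z w ≤ δ → poincareDist (f z) (f w) ≤ Real.artanh (1 / 2) := by
  have : 0 < (1 + k) / (1 - k) := div_pos (by linarith) (by linarith)
  have hexp : Real.exp (-(8 * Real.pi ^ 2 * ((1 + k) / (1 - k)))) ∈ Ioo 0 1 :=
    ⟨Real.exp_pos _, Real.exp_lt_one_iff.2 (neg_neg_of_pos (by positivity))⟩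
  refine ⟨_, Real.artanh_pos hexp, fun f hf z hz w hw hzw => ?_⟩
  obtain ⟨g, hg, hg0, hgf⟩ := hf.exists_recentred hw
  rw [poincareDist_le_artanh_iff hz hw hexp] at hzw
  rw [poincareDist_le_artanh_iff (hf.mapsTo hz) (hf.mapsTo hw) (by norm_num), ← hgf z hz]
  exact hg.norm_apply_le_half hk0 hk1 hg0 (moebius_mem_unitDisc hw hz) hzw

theorem exists_pos_forall_poincareDist_le (hk0 : 0 ≤ k) (hk1 : k < 1) :
    ∃ C > 0, ∀ f, IsQuasiconformalDiscHomeo k f → ∀ z ∈ unitDisc, ∀ w ∈ unitDisc,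
      poincareDist (f z) (f w) ≤ Real.artanh (1 / 2) → poincareDist z w ≤ C := by
  have : 0 < (1 + k) / (1 - k) := div_pos (by linarith) (by linarith)
  have hexp : 1 - Real.exp (-(32 * Real.pi ^ 2 * ((1 + k) / (1 - k)))) ∈ Ioo 0 1 :=
    ⟨sub_pos.2 (Real.exp_lt_one_iff.2 (neg_neg_of_pos (by positivity))),
      sub_lt_self 1 (Real.exp_pos _)⟩
  refine ⟨_, Real.artanh_pos hexp, fun f hf z hz w hw hfzw => ?_⟩
  obtain ⟨g, hg, hg0, hgf⟩ := hf.exists_recentred hw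
  rw [poincareDist_le_artanh_iff (hf.mapsTo hz) (hf.mapsTo hw) (by norm_num), ← hgf z hz] at hfzw
  rw [poincareDist_le_artanh_iff hz hw hexp]
  exact hg.norm_le_of_norm_apply_le_half hk0 hk1 hg0 (moebius_mem_unitDisc hw hz) hfzw

end IsQuasiconformalDiscHomeo

end DiscHomeomorphisms

/-- For `0 ≤ k < 1`, the `k`-quasiconformal homeomorphisms of the unit disc onto itself are
quasi-isometries for the Poincaré distance, with constants that depend only on `k`.
A homeomorphism of the disc is a partial homeomorphism of `ℂ` with source and target the disc;
its values off the disc play no role. -/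
theorem mainTheorem2 (k : ℝ) (hk0 : 0 ≤ k) (hk1 : k < 1) :
    ∃ lam : ℝ, 0 < lam ∧ ∃ c : ℝ, 0 < c ∧
      ∀ f : OpenPartialHomeomorph ℂ ℂ, f.source = unitDisc → f.target = unitDisc →
        IsQuasiconformalOn k f unitDisc →
          IsQuasiIsometryOnWith poincareDist poincareDist lam c f unitDisc := by
  obtain ⟨δ, hδ, hexpand⟩ :=
    IsQuasiconformalDiscHomeo.exists_pos_forall_poincareDist_apply_le hk0 hk1
  obtain ⟨C, hC, hcontract⟩ :=
    IsQuasiconformalDiscHomeo.exists_pos_forall_poincareDist_le hk0 hk1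
  set η := Real.artanh (1 / 2)
  have hη : 0 < η := Real.artanh_pos (by norm_num)
  refine ⟨max (η / δ) (C / η), by positivity, η, hη, fun f hsource htarget hqc => ?_⟩
  have hf : IsQuasiconformalDiscHomeo k f := ⟨hsource, htarget, hqc⟩
  refine isQuasiIsometryOnWith_max (div_pos hC hη) poincareDist_nonneg
    (poincareDist_apply_le_div_mul_add hf.mapsTo hδ hη.le (hexpand f hf)) fun x hx y hy => ?_
  have hsymm := poincareDist_apply_le_div_mul_add hf.mapsTo_symm hη hC.le
    (fun z hz w hw hzw => hcontract f hf _ (hf.mapsTo_symm hz) _ (hf.mapsTo_symm hw)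
      (by rwa [hf.right_inv hz, hf.right_inv hw])) _ (hf.mapsTo hx) _ (hf.mapsTo hy)
  rw [hf.left_inv hx, hf.left_inv hy] at hsymm
  rwa [mul_add, div_mul_cancel₀ C hη.ne']
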